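/- Let $\Lambda$ be an artin algebra, i.e. an algebra over a commutative artinian ring $R$ that is finitely generated as an $R$-module, and let $\operatorname{mod}\Lambda$ be the category of finitely generated right $\Lambda$-modules. Let $\mathcal W$ be a wide subcategory of $\operatorname{mod}\Lambda$, i.e. a full subcategory closed under isomorphisms, finite direct sums (in particular containing $0$), direct summands, kernels, cokernels and extensions. Then the following are equivalent. 1. $\mathcal W$ is functorially finite, i.e. both covariantly finite and contravariantly finite. 2. $\mathcal W$ is covariantly finite: for every $X\in\operatorname{mod}\Lambda$ there is a morphism $f\colon X\to W$ with $W\in\mathcal W$ such that every morphism $X\to W'$ with $W'\in\mathcal W$ factors through $f$. 3. $\mathcal W$ is contravariantly finite: for every $X\in\operatorname{mod}\Lambda$ there is a morphism $f\colon W\to X$ with $W\in\mathcal W$ such that every morphism $W'\to X$ with $W'\in\mathcal W$ factors through $f$. 4. $\mathcal W$ has an Ext-progenerator, i.e. there is $P\in\mathcal W$ such that, writing $\mathcal P(\mathcal W)$ for the class of all $Q\in\mathcal W$ with $\operatorname{Ext}^1_\Lambda(Q,Y)=0$ for all $Y\in\mathcal W$, the following hold: $\mathcal P(\mathcal W)$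 consists exactly of the direct summands of finite direct sums of copies of $P$; and every $X\in\mathcal W$ admits a short exact sequence $0\to Y\to Q\to X\to 0$ with $Q\in\mathcal P(\mathcal W)$ and $Y\in\mathcal W$. 5. There is an artin algebra $\Gamma$ (over some commutative artinian ring, not necessarily $R$) such that $\mathcal W$ is equivalent, as a category, to the category $\operatorname{mod}\Gamma$ of finitely generated right $\Gamma$-modules. -/

import Mathlib

open CategoryTheory CategoryTheory.Limits

universe u v

/-- `Λ` is an artin `R`-algebra: `R` is a commutative artinian ring and `Λ` is an (associative,
unital) `R`-algebra which is finitely generated as an `R`-module. -/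
structure IsArtinAlgebra (R : Type v) (Λ : Type u) [CommRing R] [Ring Λ] [Algebra R Λ] : Prop where
  isArtinianRing : IsArtinianRing R
  finite : Module.Finite R Λ

/-- The category `mod Λ` of finitely generated right `Λ`-modules, that is, of finitely generated
left modules over the opposite ring. -/
abbrev RMod (Λ : Type u) [Ring Λ] := FGModuleCat.{u} Λᵐᵒᵖ

namespace RMod

variable {Λ : Type u} [Ring Λ]

/-- A subcategory of `mod Λ` in the sense used here: a full subcategory (given by its objects)
closed under isomorphisms, finite direct sums (including the zero module) and direct summands. -/
structure IsSubcategory (C : ObjectProperty (RMod Λ)) : Prop where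
  iso : C.IsClosedUnderIsomorphisms
  directSum : C.IsClosedUnderFiniteCoproducts
  directSummand : C.IsStableUnderRetracts

/-- A wide subcategory of `mod Λ`: a subcategory closed under kernels, cokernels and extensions. -/
structure IsWide (C : ObjectProperty (RMod Λ)) : Prop extends IsSubcategory C where
  kernel : C.IsClosedUnderKernels
  cokernel : C.IsClosedUnderCokernels
  extension : C.IsClosedUnderExtensions

/-- `C` is covariantly finite: every `X` in `mod Λ` has a left `C`-approximation. -/
def IsCovariantlyFinite (C : ObjectProperty (RMod Λ)) : Prop :=
  ∀ X : RMod Λ, ∃ (Z : RMod Λ) (f : X ⟶ Z), C Z ∧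
    ∀ (Z' : RMod Λ) (g : X ⟶ Z'), C Z' → ∃ h : Z ⟶ Z', f ≫ h = g

/-- `C` is contravariantly finite: every `X` in `mod Λ` has a right `C`-approximation. -/
def IsContravariantlyFinite (C : ObjectProperty (RMod Λ)) : Prop :=
  ∀ X : RMod Λ, ∃ (Z : RMod Λ) (f : Z ⟶ X), C Z ∧
    ∀ (Z' : RMod Λ) (g : Z' ⟶ X), C Z' → ∃ h : Z' ⟶ Z, h ≫ f = g

/-- `C` is functorially finite: it is both covariantly and contravariantly finite. -/
def IsFunctoriallyFinite (C : ObjectProperty (RMod Λ)) : Prop :=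
  IsCovariantlyFinite C ∧ IsContravariantlyFinite C

/-- `add P`: the direct summands of finite direct sums of copies of `P`. -/
def add (P : RMod Λ) : ObjectProperty (RMod Λ) := fun X =>
  ∃ n : ℕ, Nonempty (Retract X (FGModuleCat.of Λᵐᵒᵖ (Fin n → P)))

/-- The objects `X` of `C` which are Ext-projective in `C`, i.e. `Ext¹_Λ(X, Y) = 0` for every
`Y` in `C`; here `Ext¹_Λ` is computed in the category of all right `Λ`-modules. -/
def extProjectives (C : ObjectProperty (RMod Λ)) : ObjectProperty (RMod Λ) := fun X =>
  C X ∧ ∀ Y : RMod Λ, C Y → Subsingleton (Abelian.Ext.{u} X.obj Y.obj 1)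

/-- `C` has enough Ext-projectives: every `X` in `C` admits a short exact sequence
`0 ⟶ Y ⟶ P ⟶ X ⟶ 0` in `mod Λ` with `P` Ext-projective in `C` and `Y` in `C`. -/
def HasEnoughExtProjectives (C : ObjectProperty (RMod Λ)) : Prop :=
  ∀ X : RMod Λ, C X → ∃ (Y P : RMod Λ) (f : Y ⟶ P) (g : P ⟶ X) (w : f ≫ g = 0),
    C Y ∧ extProjectives C P ∧ (ShortComplex.mk f g w).ShortExact

/-- `P` is an Ext-progenerator of `C`. -/
def IsExtProgenerator (C : ObjectProperty (RMod Λ)) (P : RMod Λ) : Prop :=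
  C P ∧ add P = extProjectives C ∧ HasEnoughExtProjectives C

end RMod

/-! Inside a module of `W`, the submodules belonging to `W` are closed under sums and intersections.
By finite length, every subset lies in a smallest such submodule and every submodule contains a
largest one. These extremal submodules produce all the approximations below.

The pivot is a universal element: some `z` in a module `Z` of `W` whose images under maps out of `Z`
exhaust every module of `W`. This is a left approximation of the regular module. Let `D` be the
smallest `W`-submodule containing `z`. Maps from `D` into `W` are determined by their value at `z`
and take every value there, so `D` corepresents the forgetful functor on `W`. Hence `D` has the
lifting property against surjections in `W` and generates `W`; by `isExtProgenerator_iff` this is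
what an Ext-progenerator is.

Conversely, if `P` generates `W`, a tuple of `R`-generators of `P` is universal in a power of `P`,
which gives left approximations of all modules. Right approximations of `X` come from `R`-generators
of `Hom(P, X)`, after dividing `P^k` by the largest `W`-submodule of the kernel of `P^k → X`.

If `W` is contravariantly finite, a right approximation `I` of a finitely generated cogenerator of
`mod Λ` cogenerates `W`. A tuple of `R`-generators of `I` is then universal in the smallest
`W`-submodule of `I^k` containing it.

The last equivalence is Morita theory: `Hom(P, -)` identifies `W` with `mod (End P)`, and an
equivalence with `mod Γ` carries the regular module to a progenerator. -/

section Cogenerator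

/-! ### A finitely generated cogenerator over an artin algebra. -/

theorem Module.exists_injective_embedding {A : Type u} [Ring A] (T : Type u) [AddCommGroup T]
    [Module A T] : ∃ (E : Type u) (_ : AddCommGroup E) (_ : Module A E) (_ : Module.Injective A E)
      (i : T →ₗ[A] E), Function.Injective i := by
  obtain ⟨p⟩ := EnoughInjectives.presentation (ModuleCat.of A T)
  have : CategoryTheory.Injective (ModuleCat.of A p.J) := p.injective
  exact ⟨p.J, inferInstance, inferInstance, Module.injective_module_of_injective_object A p.J,
    p.f.hom, (ModuleCat.mono_iff_injective p.f).1 p.mono⟩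

/-- A submodule which is maximal among those meeting `T` trivially: the image of `T` in the
quotient is then essential. -/
theorem Submodule.exists_disjoint_essential {A E : Type*} [Ring A] [AddCommGroup E] [Module A E]
    (T : Submodule A E) : ∃ C : Submodule A E, Disjoint C T ∧
      ∀ D : Submodule A (E ⧸ C), D ≠ ⊥ → D ⊓ T.map C.mkQ ≠ ⊥ := by
  obtain ⟨C, -, hC⟩ := zorn_le_nonempty₀ {C : Submodule A E | Disjoint C T} (by
    intro c hc hchain y hy
    refine ⟨sSup c, ?_, fun z hz => le_sSup hz⟩
    change Disjoint (sSup c) T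
    rw [Submodule.disjoint_def]
    intro x hx hxT
    obtain ⟨z, hz, hxz⟩ := (Submodule.mem_sSup_of_directed ⟨y, hy⟩ hchain.directedOn).1 hx
    exact Submodule.disjoint_def.1 (hc hz) x hxz hxT) ⊥ disjoint_bot_left
  refine ⟨C, hC.prop, fun D hD h => hD ?_⟩
  have hle : C ≤ D.comap C.mkQ := fun x hx => by
    simp [(Submodule.Quotient.mk_eq_zero C).2 hx]
  have hdis : Disjoint (D.comap C.mkQ) T := by
    rw [Submodule.disjoint_def]
    intro x hxD hxT
    have : C.mkQ x ∈ D ⊓ T.map C.mkQ := ⟨hxD, Submodule.mem_map_of_mem hxT⟩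
    rw [h, Submodule.mem_bot, Submodule.mkQ_apply, Submodule.Quotient.mk_eq_zero] at this
    exact Submodule.disjoint_def.1 hC.prop x this hxT
  have := hC.eq_of_ge hdis hle
  rw [eq_bot_iff]
  intro d hd
  obtain ⟨x, rfl⟩ := C.mkQ_surjective d
  have hx : x ∈ C := by rw [← this]; exact hd
  simp [(Submodule.Quotient.mk_eq_zero C).2 hx]

theorem LinearMap.isNoetherian_of_finite {R A M N : Type*} [CommRing R] [Ring A] [Algebra R A]
    [IsNoetherianRing R] [Module.Finite R A]
    [AddCommGroup M] [AddCommGroup N] [Module A M] [Module A N] [Module R N]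
    [IsScalarTower R A N] [Module.Finite A M] [Module.Finite A N] [SMulCommClass A R N] :
    IsNoetherian R (M →ₗ[A] N) := by
  obtain ⟨n, s, hs⟩ := Module.Finite.exists_fin (R := A) (M := M)
  have : Module.Finite R N := Module.Finite.trans A N
  let ev : (M →ₗ[A] N) →ₗ[R] (Fin n → N) :=
    { toFun := fun f i => f (s i)
      map_add' := fun _ _ => rfl
      map_smul' := fun _ _ => rfl }
  refine isNoetherian_of_injective ev fun f g h => ?_
  refine LinearMap.ext_on_range hs fun i => congr_fun h i

/-- If `M` has finite length and all homomorphisms from simple modules to `Q` land in a finitely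
generated submodule `T`, then `Hom(M, Q)` is noetherian over the base ring. -/
theorem LinearMap.isNoetherian_of_isFiniteLength {R A Q : Type*} [CommRing R] [Ring A]
    [Algebra R A] [IsNoetherianRing R] [Module.Finite R A] [AddCommGroup Q] [Module A Q]
    [Module R Q] [IsScalarTower R A Q] [SMulCommClass A R Q] (T : Submodule A Q)
    [Module.Finite A T] {M : Type*} [AddCommGroup M] [Module A M] (hM : IsFiniteLength A M)
    (hT : ∀ (D : Submodule A Q), IsSimpleModule A D → D ≤ T) :
    IsNoetherian R (M →ₗ[A] Q) := by
  induction hM with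
  | of_subsingleton => infer_instance
  | @of_simple_quotient M _ _ N hsimple hN ih =>
    let r : (M →ₗ[A] Q) →ₗ[R] (N →ₗ[A] Q) :=
      { toFun := fun f => f ∘ₗ N.subtype
        map_add' := fun _ _ => rfl
        map_smul' := fun _ _ => rfl }
    let i : ((M ⧸ N) →ₗ[A] Q) →ₗ[R] (M →ₗ[A] Q) :=
      { toFun := fun f => f ∘ₗ N.mkQ
        map_add' := fun _ _ => rfl
        map_smul' := fun _ _ => rfl }
    let j : ((M ⧸ N) →ₗ[A] T) →ₗ[R] ((M ⧸ N) →ₗ[A] Q) :=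
      { toFun := fun f => T.subtype ∘ₗ f
        map_add' := fun _ _ => rfl
        map_smul' := fun _ _ => rfl }
    -- A nonzero map from a simple module has simple image, which lies in `T`.
    have hj : Function.Surjective j := by
      intro f
      have hf : LinearMap.range f ≤ T := by
        rcases LinearMap.injective_or_eq_zero f with h | h
        · exact hT _ (IsSimpleModule.congr (LinearEquiv.ofInjective f h).symm)
        · simp [h]
      exact ⟨f.codRestrict T fun x => hf ⟨x, rfl⟩, rfl⟩
    have : Module.Finite A (M ⧸ N) := inferInstance
    have : IsNoetherian R ((M ⧸ N) →ₗ[A] T) := LinearMap.isNoetherian_of_finite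
    have : IsNoetherian R ((M ⧸ N) →ₗ[A] Q) :=
      isNoetherian_of_surjective j (LinearMap.range_eq_top.2 hj)
    refine isNoetherian_of_range_eq_ker i r (le_antisymm ?_ ?_)
    · rintro _ ⟨f, rfl⟩
      ext x
      simp [i, r, (Submodule.Quotient.mk_eq_zero N).2 x.2]
    · intro f hf
      refine ⟨N.liftQ f fun x hx => ?_, ?_⟩
      · exact congr($hf ⟨x, hx⟩)
      · ext x; rfl

/-- Over an artin algebra the category of finitely generated modules has a cogenerator. -/
theorem Module.exists_finite_cogenerator (R : Type v) (A : Type u) [CommRing R] [Ring A]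
    [Algebra R A] [IsArtinianRing R] [Module.Finite R A] :
    ∃ (Q : Type u) (_ : AddCommGroup Q) (_ : Module A Q), Module.Finite A Q ∧
      ∀ (M : Type u) [AddCommGroup M] [Module A M] (x : M), x ≠ 0 →
        ∃ f : M →ₗ[A] Q, f x ≠ 0 := by
  have : IsArtinianRing A := IsArtinianRing.of_finite R A
  have hss : IsSemisimpleModule A (A ⧸ Ring.jacobson A) :=
    (IsArtinian.isSemisimpleModule_iff_jacobson A _).2 (Module.jacobson_quotient_jacobson A A)
  obtain ⟨E, _, _, _, i, hi⟩ := Module.exists_injective_embedding (A := A) (A ⧸ Ring.jacobson A)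
  obtain ⟨C, hdis, hess⟩ := Submodule.exists_disjoint_essential (LinearMap.range i)
  let T := (LinearMap.range i).map C.mkQ
  let : Module R (E ⧸ C) := Module.compHom _ (algebraMap R A)
  have : IsScalarTower R A (E ⧸ C) := ⟨fun r a x => by
    rw [Algebra.smul_def, mul_smul]; rfl⟩
  have : SMulCommClass A R (E ⧸ C) := ⟨fun a r x => by
    change a • algebraMap R A r • x = algebraMap R A r • a • x
    rw [smul_smul, smul_smul, Algebra.commutes]⟩
  -- This Hom is `E ⧸ C` itself. By essentiality every simple submodule of `E ⧸ C` lies in `T`, a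
  -- finitely generated module.
  have hnoeth : IsNoetherian R (A →ₗ[A] (E ⧸ C)) := by
    refine LinearMap.isNoetherian_of_isFiniteLength T
      (isFiniteLength_iff_isNoetherian_isArtinian.2 ⟨inferInstance, inferInstance⟩)
      fun D hD => ?_
    have := hess D fun h => ?_
    · exact inf_eq_left.1 (((isSimpleModule_iff_isAtom.1 hD).le_iff.1 inf_le_left).resolve_left this)
    · subst h
      exact (isSimpleModule_iff_isAtom.1 hD).1 rfl
  refine ⟨E ⧸ C, inferInstance, inferInstance, ?_, fun M _ _ x hx => ?_⟩
  · let ev : (A →ₗ[A] (E ⧸ C)) →ₗ[R] (E ⧸ C) :=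
      { toFun := fun f => f 1
        map_add' := fun _ _ => rfl
        map_smul' := fun _ _ => rfl }
    have : IsNoetherian R (E ⧸ C) := isNoetherian_of_surjective ev
      (LinearMap.range_eq_top.2 fun y => ⟨LinearMap.toSpanSingleton A _ y, by simp [ev]⟩)
    have : Module.Finite R (E ⧸ C) := inferInstance
    exact Module.Finite.of_restrictScalars_finite R A _
  · obtain ⟨m, hm, hle⟩ : ∃ m : Ideal A, m.IsMaximal ∧
        LinearMap.ker (LinearMap.toSpanSingleton A M x) ≤ m := by
      refine Ideal.exists_le_maximal _ fun h => hx ?_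
      have : (1 : A) ∈ LinearMap.ker (LinearMap.toSpanSingleton A M x) := h ▸ trivial
      simpa using this
    have hJ : Ring.jacobson A ≤ m := Ring.jacobson_le_of_isMaximal m
    -- the simple quotient `A ⧸ m` embeds into `A ⧸ jacobson`
    obtain ⟨s, hs⟩ := IsSemisimpleModule.lifting_property (Submodule.factor hJ)
      (Submodule.factor_surjective hJ) (LinearMap.id (R := A) (M := A ⧸ m))
    have hs' : Function.Injective s := Function.LeftInverse.injective fun y => congr($hs y)
    let φ : LinearMap.range (LinearMap.toSpanSingleton A M x) →ₗ[A] (A ⧸ m) :=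
      (Submodule.factor hle) ∘ₗ
        (LinearMap.quotKerEquivRange (LinearMap.toSpanSingleton A M x)).symm.toLinearMap
    -- The map is extended into the injective module `E` and only then projected to `E ⧸ C`. The
    -- image of `x` lies in the range of `i`, which meets `C` trivially, so it survives.
    obtain ⟨g, hg⟩ := Module.Injective.extension_property A E _ M (Submodule.subtype _)
      (Submodule.subtype_injective _) (i ∘ₗ s ∘ₗ φ)
    let x' : LinearMap.range (LinearMap.toSpanSingleton A M x) := ⟨x, 1, by simp⟩
    have hφ : φ x' = Submodule.Quotient.mk 1 := by
      have : x' = LinearMap.quotKerEquivRange (LinearMap.toSpanSingleton A M x)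
          (Submodule.Quotient.mk 1) := by
        ext; simp [x']
      simp only [φ, LinearMap.comp_apply, this]
      simp
    have hφ0 : φ x' ≠ 0 := by
      rw [hφ]
      intro h
      exact hm.ne_top ((Ideal.eq_top_iff_one m).2 ((Submodule.Quotient.mk_eq_zero m).1 h))
    have hgx : g x = i (s (φ x')) := congr($hg x')
    refine ⟨C.mkQ ∘ₗ g, fun h => hφ0 ?_⟩
    have hC : g x ∈ C := (Submodule.Quotient.mk_eq_zero C).1 h
    have := Submodule.disjoint_def.1 hdis (g x) hC (hgx ▸ ⟨_, rfl⟩)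
    rw [hgx] at this
    exact hs' (hi (by rw [this, map_zero, map_zero]))

end Cogenerator

/-! ### Kernels, cokernels and short exact sequences of finitely generated modules. -/

namespace FGModuleCat

variable {A : Type u} [Ring A]

theorem epi_iff_surjective [IsNoetherianRing A] {X Y : FGModuleCat.{u} A} (f : X ⟶ Y) :
    Epi f ↔ Function.Surjective f.hom.hom := by
  refine ⟨fun h => ?_, fun h => ⟨fun {Z} a b hab => ?_⟩⟩
  · let q : Y ⟶ of A (Y ⧸ LinearMap.range f.hom.hom) := ofHom (LinearMap.range f.hom.hom).mkQ
    have : q = ofHom 0 := by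
      rw [← cancel_epi f]
      ext x
      exact (Submodule.Quotient.mk_eq_zero _).2 ⟨x, rfl⟩
    intro y
    exact (Submodule.Quotient.mk_eq_zero _).1 congr(($this).hom.hom y)
  · ext y
    obtain ⟨x, rfl⟩ := h y
    exact congr(($hab).hom.hom x)

theorem mono_of_injective {X Y : FGModuleCat.{u} A} (f : X ⟶ Y)
    (h : Function.Injective f.hom.hom) : Mono f :=
  ⟨fun a b hab => by
    ext z
    exact h congr(($hab).hom.hom z)⟩

variable {M N K : Type u} [AddCommGroup M] [Module A M] [Module.Finite A M]
  [AddCommGroup N] [Module A N] [Module.Finite A N]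
  [AddCommGroup K] [Module A K] [Module.Finite A K]

/-- An injective linear map onto the kernel of `g` is a kernel of `g` in `FGModuleCat A`. -/
noncomputable def isLimitKernelFork (f : K →ₗ[A] M) (g : M →ₗ[A] N) (hf : Function.Injective f)
    (hfg : LinearMap.range f = LinearMap.ker g) :
    IsLimit (KernelFork.ofι (f := ofHom g) (ofHom f) (by
      ext x; exact LinearMap.mem_ker.1 (hfg.le ⟨x, rfl⟩))) :=
  haveI : Mono (ofHom f) := mono_of_injective _ hf
  KernelFork.IsLimit.ofι' (ofHom f) _ fun {Z} k hk =>
    ⟨ofHom (V := Z) ((LinearEquiv.ofInjective f hf).symm.toLinearMap ∘ₗ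
      k.hom.hom.codRestrict (LinearMap.range f) fun z => by
        rw [hfg]; exact congr(($hk).hom.hom z)), by
      ext z
      exact congr(($((LinearEquiv.ofInjective f hf).apply_symm_apply
        (k.hom.hom.codRestrict (LinearMap.range f) _ z))).1)⟩

/-- The projection to `N ⧸ range f` is a cokernel of `f` in `FGModuleCat A`. -/
noncomputable def isColimitCokernelCofork [IsNoetherianRing A] (f : M →ₗ[A] N) :
    IsColimit (CokernelCofork.ofπ (f := ofHom f) (ofHom (LinearMap.range f).mkQ) (by
      ext x; exact (Submodule.Quotient.mk_eq_zero _).2 ⟨x, rfl⟩)) :=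
  haveI : Epi (ofHom (LinearMap.range f).mkQ) :=
    (epi_iff_surjective _).2 (Submodule.mkQ_surjective _)
  CokernelCofork.IsColimit.ofπ' (ofHom (LinearMap.range f).mkQ) _ fun {Z} k hk =>
    ⟨ofHom (W := Z) ((LinearMap.range f).liftQ k.hom.hom (by
      rintro _ ⟨x, rfl⟩
      exact congr(($hk).hom.hom x))), by
      ext z; rfl⟩

theorem shortExact_of_linearMap [IsNoetherianRing A] (f : K →ₗ[A] M) (g : M →ₗ[A] N)
    (hf : Function.Injective f) (hg : Function.Surjective g)
    (hfg : LinearMap.range f = LinearMap.ker g) :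
    ∃ w, (ShortComplex.mk (ofHom f) (ofHom g) w).ShortExact := by
  have w : ofHom f ≫ ofHom g = 0 := by
    ext x; exact LinearMap.mem_ker.1 (hfg.le ⟨x, rfl⟩)
  refine ⟨w, ?_⟩
  have hm : Mono (ofHom f) := mono_of_injective _ hf
  have he : Epi (ofHom g) := (epi_iff_surjective _).2 hg
  exact
    { exact := ShortComplex.exact_of_f_is_kernel _ (isLimitKernelFork f g hf hfg)
      mono_f := hm
      epi_g := he }

end FGModuleCat

/-! ### The lattice of submodules belonging to a wide subcategory. -/

namespace RMod

variable {Λ : Type u} [Ring Λ] {W : ObjectProperty (RMod Λ)}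

/-- The subcategory `W` contains the module `M`. -/
abbrev Contains (W : ObjectProperty (RMod Λ)) (M : Type u) [AddCommGroup M] [Module Λᵐᵒᵖ M]
    [Module.Finite Λᵐᵒᵖ M] : Prop :=
  W (FGModuleCat.of Λᵐᵒᵖ M)

theorem contains_of_eq {M : Type u} [AddCommGroup M] [Module Λᵐᵒᵖ M] {D E : Submodule Λᵐᵒᵖ M}
    [Module.Finite Λᵐᵒᵖ D] [Module.Finite Λᵐᵒᵖ E]
    (h : D = E) (hD : Contains W D) : Contains W E := by
  subst h; exact hD

variable {M N K : Type u} [AddCommGroup M] [Module Λᵐᵒᵖ M] [Module.Finite Λᵐᵒᵖ M]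
  [AddCommGroup N] [Module Λᵐᵒᵖ N] [Module.Finite Λᵐᵒᵖ N]
  [AddCommGroup K] [Module Λᵐᵒᵖ K] [Module.Finite Λᵐᵒᵖ K]

namespace IsWide

theorem contains_of_equiv (hW : IsWide W) (e : M ≃ₗ[Λᵐᵒᵖ] N) (hM : Contains W M) :
    Contains W N :=
  have := hW.iso
  W.prop_of_iso e.toFGModuleCatIso hM

variable [IsNoetherianRing Λᵐᵒᵖ]

theorem contains_ker (hW : IsWide W) (f : M →ₗ[Λᵐᵒᵖ] N) (hM : Contains W M)
    (hN : Contains W N) : Contains W (LinearMap.ker f) :=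
  have := hW.kernel
  W.prop_of_isLimit_kernelFork (FGModuleCat.isLimitKernelFork (LinearMap.ker f).subtype f
    (Submodule.subtype_injective _) (Submodule.range_subtype _)) hM hN

theorem contains_quotient_range (hW : IsWide W) (f : M →ₗ[Λᵐᵒᵖ] N) (hM : Contains W M)
    (hN : Contains W N) : Contains W (N ⧸ LinearMap.range f) :=
  have := hW.cokernel
  W.prop_of_isColimit_cokernelCofork (FGModuleCat.isColimitCokernelCofork f) hM hN

theorem contains_of_extension (hW : IsWide W) (f : K →ₗ[Λᵐᵒᵖ] M) (g : M →ₗ[Λᵐᵒᵖ] N)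
    (hf : Function.Injective f) (hg : Function.Surjective g)
    (hfg : LinearMap.range f = LinearMap.ker g) (hK : Contains W K) (hN : Contains W N) :
    Contains W M :=
  have := hW.extension
  have ⟨_, h⟩ := FGModuleCat.shortExact_of_linearMap f g hf hg hfg
  W.prop_X₂_of_shortExact h hK hN

theorem contains_quotient (hW : IsWide W) (D : Submodule Λᵐᵒᵖ M) (hM : Contains W M)
    (hD : Contains W D) : Contains W (M ⧸ D) := by
  have := hW.contains_quotient_range D.subtype hD hM
  rwa [Submodule.range_subtype] at this

theorem contains_of_quotient (hW : IsWide W) (D : Submodule Λᵐᵒᵖ M) (hM : Contains W M)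
    (hD : Contains W (M ⧸ D)) : Contains W D := by
  have := hW.contains_ker D.mkQ hM hD
  rwa [Submodule.ker_mkQ] at this

/-- The image is the kernel of the projection onto the cokernel. -/
theorem contains_range (hW : IsWide W) (f : M →ₗ[Λᵐᵒᵖ] N) (hM : Contains W M)
    (hN : Contains W N) : Contains W (LinearMap.range f) :=
  hW.contains_of_quotient _ hN (hW.contains_quotient_range f hM hN)

theorem contains_map (hW : IsWide W) (f : M →ₗ[Λᵐᵒᵖ] N) (D : Submodule Λᵐᵒᵖ M)
    (hD : Contains W D) (hN : Contains W N) : Contains W (D.map f) :=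
  contains_of_eq (by rw [LinearMap.range_comp, Submodule.range_subtype])
    (hW.contains_range (f ∘ₗ D.subtype) hD hN)

theorem contains_comap (hW : IsWide W) (f : M →ₗ[Λᵐᵒᵖ] N) (D : Submodule Λᵐᵒᵖ N)
    (hM : Contains W M) (hN : Contains W N) (hD : Contains W D) :
    Contains W (D.comap f) := by
  have := hW.contains_ker (D.mkQ ∘ₗ f) hM (hW.contains_quotient D hN hD)
  rwa [LinearMap.ker_comp, Submodule.ker_mkQ] at this

/-- The intersection is the image in `M` of the preimage of `E` in `D`. Together with `contains_sup`
this yields least and greatest `W`-submodules. -/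
theorem contains_inf (hW : IsWide W) (D E : Submodule Λᵐᵒᵖ M) (hM : Contains W M)
    (hD : Contains W D) (hE : Contains W E) : Contains W (D ⊓ E : Submodule Λᵐᵒᵖ M) :=
  contains_of_eq (Submodule.map_comap_subtype D E)
    (hW.contains_map D.subtype _ (hW.contains_comap D.subtype E hD hM hE) hM)

/-- The sum is the preimage under `M → M ⧸ D` of the image of `E`. -/
theorem contains_sup (hW : IsWide W) (D E : Submodule Λᵐᵒᵖ M) (hM : Contains W M)
    (hD : Contains W D) (hE : Contains W E) : Contains W (D ⊔ E : Submodule Λᵐᵒᵖ M) := by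
  have hMD := hW.contains_quotient D hM hD
  have := hW.contains_comap D.mkQ _ hM hMD (hW.contains_map D.mkQ E hE hMD)
  rwa [Submodule.comap_map_mkQ] at this

theorem contains_of_subsingleton (hW : IsWide W) (hM : Contains W M) [Subsingleton N] :
    Contains W N := by
  have h := hW.contains_ker (LinearMap.id (R := Λᵐᵒᵖ) (M := M)) hM hM
  have : Subsingleton (LinearMap.ker (LinearMap.id (R := Λᵐᵒᵖ) (M := M))) := by
    rw [LinearMap.ker_id]; infer_instance
  exact hW.contains_of_equiv (LinearEquiv.ofSubsingleton _ N) h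

theorem contains_pi (hW : IsWide W) (n : ℕ) (hM : Contains W M) : Contains W (Fin n → M) := by
  induction n with
  | zero => exact hW.contains_of_subsingleton hM
  | succ n ih =>
    have hprod : Contains W (M × (Fin n → M)) :=
      hW.contains_of_extension (LinearMap.inl Λᵐᵒᵖ M (Fin n → M)) (LinearMap.snd _ _ _)
        LinearMap.inl_injective LinearMap.snd_surjective
        (LinearMap.range_inl _ _ _) hM ih
    exact hW.contains_of_equiv (Fin.consLinearEquiv Λᵐᵒᵖ (fun _ : Fin (n + 1) => M)) hprod

/-- Every subset of a module in `W` is contained in a smallest submodule belonging to `W`. -/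
theorem exists_least_submodule [IsArtinianRing Λᵐᵒᵖ] (hW : IsWide W) (hM : Contains W M)
    (S : Set M) : ∃ D : Submodule Λᵐᵒᵖ M, Contains W D ∧ S ⊆ D ∧
      ∀ E : Submodule Λᵐᵒᵖ M, Contains W E → S ⊆ E → D ≤ E := by
  obtain ⟨D, ⟨hD, hS⟩, hmin⟩ := IsArtinian.set_has_minimal
    {D : Submodule Λᵐᵒᵖ M | Contains W D ∧ S ⊆ D}
    ⟨⊤, hW.contains_of_equiv Submodule.topEquiv.symm hM, fun _ _ => trivial⟩
  refine ⟨D, hD, hS, fun E hE hSE => ?_⟩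
  have h := hmin (D ⊓ E) ⟨hW.contains_inf D E hM hD hE, Set.subset_inter hS hSE⟩
  exact inf_eq_left.1 (eq_of_le_of_not_lt inf_le_left h)

/-- Every submodule of a module in `W` contains a largest submodule belonging to `W`. -/
theorem exists_greatest_submodule (hW : IsWide W) (hM : Contains W M)
    (K : Submodule Λᵐᵒᵖ M) : ∃ D : Submodule Λᵐᵒᵖ M, Contains W D ∧ D ≤ K ∧
      ∀ E : Submodule Λᵐᵒᵖ M, Contains W E → E ≤ K → E ≤ D := by
  obtain ⟨D, ⟨hD, hS⟩, hmax⟩ := set_has_maximal_iff_noetherian.2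
    (inferInstance : IsNoetherian Λᵐᵒᵖ M)
    {D : Submodule Λᵐᵒᵖ M | Contains W D ∧ D ≤ K}
    ⟨⊥, hW.contains_of_subsingleton hM, bot_le⟩
  refine ⟨D, hD, hS, fun E hE hSE => ?_⟩
  have h := hmax (D ⊔ E) ⟨hW.contains_sup D E hM hD hE, sup_le hS hSE⟩
  exact sup_eq_left.1 (eq_of_le_of_not_lt le_sup_left h).symm

end IsWide

end RMod

/-! ### Short exact sequences of modules and pushout extensions. -/

theorem ModuleCat.shortExact_of_linearMap {A : Type u} [Ring A] {K M N : Type u}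
    [AddCommGroup K] [Module A K] [AddCommGroup M] [Module A M] [AddCommGroup N] [Module A N]
    (f : K →ₗ[A] M) (g : M →ₗ[A] N) (hf : Function.Injective f) (hg : Function.Surjective g)
    (hfg : LinearMap.range f = LinearMap.ker g) :
    ∃ w, (ShortComplex.mk (ModuleCat.ofHom f) (ModuleCat.ofHom g) w).ShortExact := by
  have w : ModuleCat.ofHom f ≫ ModuleCat.ofHom g = 0 := by
    ext x; exact LinearMap.mem_ker.1 (hfg.le ⟨x, rfl⟩)
  exact ⟨w, {
    exact := (ShortComplex.moduleCat_exact_iff_range_eq_ker _).2 hfg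
    mono_f := (ModuleCat.mono_iff_injective _).2 hf
    epi_g := (ModuleCat.epi_iff_surjective _).2 hg }⟩

section Pushout

variable {A : Type*} [Ring A] {F Y P : Type*} [AddCommGroup F] [Module A F]
  [AddCommGroup Y] [Module A Y] [AddCommGroup P] [Module A P]

/-- The relations of the pushout of `F` and `Y` along `ker π ⊆ F` and `φ : ker π → Y`. -/
abbrev LinearMap.pushoutRelations (π : F →ₗ[A] P) (φ : LinearMap.ker π →ₗ[A] Y) :
    Submodule A (F × Y) :=
  LinearMap.range ((LinearMap.ker π).subtype.prod (-φ))

variable (π : F →ₗ[A] P) (φ : LinearMap.ker π →ₗ[A] Y)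

/-- The projection of the pushout extension onto `P`. -/
def LinearMap.pushoutProj : ((F × Y) ⧸ LinearMap.pushoutRelations π φ) →ₗ[A] P :=
  (LinearMap.pushoutRelations π φ).liftQ (π ∘ₗ LinearMap.fst A F Y) (by
    rintro _ ⟨x, rfl⟩
    exact x.2)

/-- The inclusion of `Y` into the pushout extension. -/
def LinearMap.pushoutInr : Y →ₗ[A] ((F × Y) ⧸ LinearMap.pushoutRelations π φ) :=
  (LinearMap.pushoutRelations π φ).mkQ ∘ₗ LinearMap.inr A F Y

theorem LinearMap.pushoutInr_injective : Function.Injective (LinearMap.pushoutInr π φ) := by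
  rw [injective_iff_map_eq_zero]
  intro y hy
  obtain ⟨x, hx⟩ := (Submodule.Quotient.mk_eq_zero _).1 hy
  have h1 : x = 0 := Subtype.ext congr(($hx).1)
  have h2 : -φ x = y := congr(($hx).2)
  rw [← h2, h1, map_zero, neg_zero]

theorem LinearMap.pushoutProj_surjective (hπ : Function.Surjective π) :
    Function.Surjective (LinearMap.pushoutProj π φ) := fun p => by
  obtain ⟨x, rfl⟩ := hπ p
  exact ⟨Submodule.Quotient.mk (x, 0), rfl⟩

theorem LinearMap.range_pushoutInr :
    LinearMap.range (LinearMap.pushoutInr π φ) = LinearMap.ker (LinearMap.pushoutProj π φ) := by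
  refine le_antisymm ?_ fun z hz => ?_
  · rintro _ ⟨y, rfl⟩
    exact map_zero π
  · obtain ⟨⟨x, y⟩, rfl⟩ := Submodule.mkQ_surjective _ z
    have hx : π x = 0 := hz
    refine ⟨y + φ ⟨x, hx⟩, (Submodule.Quotient.eq _).2 ⟨-⟨x, hx⟩, ?_⟩⟩
    ext <;> simp

/-- A section of the pushout extension yields an extension of `φ` to `F`. -/
theorem LinearMap.exists_extend_of_pushoutProj_section
    (s : P →ₗ[A] ((F × Y) ⧸ LinearMap.pushoutRelations π φ))
    (hs : LinearMap.pushoutProj π φ ∘ₗ s = LinearMap.id) :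
    ∃ ψ : F →ₗ[A] Y, ψ ∘ₗ (LinearMap.ker π).subtype = φ := by
  let e := LinearEquiv.ofInjective _ (LinearMap.pushoutInr_injective π φ)
  -- Both terms project to `π x`, so the difference lands in `Y`. On `ker π` the correction `s ∘ π`
  -- vanishes, and the relations identify `(x, 0)` with `(0, φ x)`.
  let d : F →ₗ[A] ((F × Y) ⧸ LinearMap.pushoutRelations π φ) :=
    (LinearMap.pushoutRelations π φ).mkQ ∘ₗ LinearMap.inl A F Y - s ∘ₗ π
  have hd : ∀ x, d x ∈ LinearMap.range (LinearMap.pushoutInr π φ) := fun x => by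
    rw [LinearMap.range_pushoutInr, LinearMap.mem_ker]
    have h1 : LinearMap.pushoutProj π φ (s (π x)) = π x := congr($hs (π x))
    have h2 : LinearMap.pushoutProj π φ (Submodule.Quotient.mk (x, 0)) = π x := rfl
    simp [d, h1, h2]
  refine ⟨e.symm.toLinearMap ∘ₗ d.codRestrict _ hd, ?_⟩
  ext x
  refine (LinearEquiv.symm_apply_eq e).2 (Subtype.ext ?_)
  have hx : π x = 0 := x.2
  change d x = LinearMap.pushoutInr π φ (φ x)
  simp only [d, LinearMap.sub_apply, LinearMap.comp_apply, hx, map_zero, sub_zero]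
  refine (Submodule.Quotient.eq _).2 ⟨x, ?_⟩
  ext <;> simp

end Pushout

/-! ### Ext-progenerators as generators with a lifting property. -/

namespace RMod

variable {Λ : Type u} [Ring Λ] {W : ObjectProperty (RMod Λ)}

/-- `P` has the lifting property against the surjections between modules in `W`. -/
def IsRelProjective (W : ObjectProperty (RMod Λ)) (P : Type u) [AddCommGroup P]
    [Module Λᵐᵒᵖ P] : Prop :=
  ∀ ⦃M N : Type u⦄ [AddCommGroup M] [Module Λᵐᵒᵖ M] [Module.Finite Λᵐᵒᵖ M]
    [AddCommGroup N] [Module Λᵐᵒᵖ N] [Module.Finite Λᵐᵒᵖ N], Contains W M → Contains W N →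
    ∀ (p : M →ₗ[Λᵐᵒᵖ] N) (g : P →ₗ[Λᵐᵒᵖ] N), Function.Surjective p → ∃ h, p ∘ₗ h = g

theorem IsRelProjective.of_retract {P Q : Type u} [AddCommGroup P] [Module Λᵐᵒᵖ P]
    [AddCommGroup Q] [Module Λᵐᵒᵖ Q] (hP : IsRelProjective W P) (i : Q →ₗ[Λᵐᵒᵖ] P)
    (r : P →ₗ[Λᵐᵒᵖ] Q) (h : r ∘ₗ i = LinearMap.id) : IsRelProjective W Q := by
  intro M N _ _ _ _ _ _ hM hN p g hp
  obtain ⟨k, hk⟩ := hP hM hN p (g ∘ₗ r) hp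
  exact ⟨k ∘ₗ i, by rw [← LinearMap.comp_assoc, hk, LinearMap.comp_assoc, h, LinearMap.comp_id]⟩

theorem IsRelProjective.pi {P : Type u} [AddCommGroup P] [Module Λᵐᵒᵖ P]
    (hP : IsRelProjective W P) (n : ℕ) : IsRelProjective W (Fin n → P) := by
  intro M N _ _ _ _ _ _ hM hN p g hp
  choose k hk using fun i => hP hM hN p (g ∘ₗ LinearMap.single Λᵐᵒᵖ (fun _ => P) i) hp
  refine ⟨LinearMap.lsum Λᵐᵒᵖ (fun _ => P) ℕ k, ?_⟩
  refine LinearMap.pi_ext' fun i => ?_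
  rw [← hk i]
  ext x
  have : LinearMap.lsum Λᵐᵒᵖ (fun _ => P) ℕ k (Pi.single i x) = k i x := by
    rw [LinearMap.lsum_apply, LinearMap.sum_apply, Finset.sum_eq_single i] <;>
      simp +contextual
  exact congrArg p this

/-- `P` generates `W`: every module in `W` is a quotient of a finite power of `P`. -/
def IsGenerator (W : ObjectProperty (RMod Λ)) (P : Type u) [AddCommGroup P]
    [Module Λᵐᵒᵖ P] : Prop :=
  ∀ ⦃M : Type u⦄ [AddCommGroup M] [Module Λᵐᵒᵖ M] [Module.Finite Λᵐᵒᵖ M], Contains W M →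
    ∃ (n : ℕ) (p : (Fin n → P) →ₗ[Λᵐᵒᵖ] M), Function.Surjective p

variable [IsNoetherianRing Λᵐᵒᵖ]

/-- The obstruction to lifting `g` along `p` lies in `Ext¹(P, ker p)`, and `ker p` belongs to `W`.
-/
theorem IsWide.isRelProjective_of_extProjectives (hW : IsWide W) {P : RMod Λ}
    (hP : extProjectives W P) : IsRelProjective W P := by
  intro M N _ _ _ _ _ _ hM hN p g hp
  have := hP.2 _ (hW.contains_ker p hM hN)
  obtain ⟨w, hS⟩ := ModuleCat.shortExact_of_linearMap (LinearMap.ker p).subtype p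
    (Submodule.subtype_injective _) hp (Submodule.range_subtype _)
  obtain ⟨x, hx⟩ := Abelian.Ext.covariant_sequence_exact₃ P.obj hS
    (Abelian.Ext.mk₀ (ModuleCat.ofHom g)) (zero_add 1) (Subsingleton.elim _ _)
  obtain ⟨h, rfl⟩ := (Abelian.Ext.mk₀_bijective _ _).2 x
  rw [Abelian.Ext.mk₀_comp_mk₀] at hx
  exact ⟨h.hom, congr(($((Abelian.Ext.mk₀_bijective _ _).1 hx)).hom)⟩

/-- Given a free cover `π : F → P`, a class in `Ext¹(P, Y)` comes from some `φ : ker π → Y`. The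
pushout extension of `P` by `Y` along `φ` lies in `W` because `W` is extension-closed, so lifting
the identity of `P` splits it. Then `φ` extends to `F` and the class vanishes. -/
theorem IsWide.extProjectives_of_isRelProjective (hW : IsWide W) {P : RMod Λ} (hPW : W P)
    (hP : IsRelProjective W P) : extProjectives W P := by
  refine ⟨hPW, fun Y hY => subsingleton_of_forall_eq 0 fun e => ?_⟩
  obtain ⟨n, π, hπ⟩ := Module.Finite.exists_fin' Λᵐᵒᵖ P
  obtain ⟨w, hS⟩ := ModuleCat.shortExact_of_linearMap (LinearMap.ker π).subtype π
    (Submodule.subtype_injective _) hπ (Submodule.range_subtype _)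
  have : Projective (ModuleCat.of Λᵐᵒᵖ (Fin n → Λᵐᵒᵖ)) :=
    (IsProjective.iff_projective _).1 inferInstance
  obtain ⟨x, rfl⟩ := Abelian.Ext.contravariant_sequence_exact₃ hS Y.obj e
    (Abelian.Ext.eq_zero_of_projective _) (add_zero 1)
  obtain ⟨φ, rfl⟩ := (Abelian.Ext.mk₀_bijective _ _).2 x
  have hE := hW.contains_of_extension _ _ (LinearMap.pushoutInr_injective π φ.hom)
    (LinearMap.pushoutProj_surjective π φ.hom hπ) (LinearMap.range_pushoutInr π φ.hom) hY hPW
  obtain ⟨s, hs⟩ := hP hE hPW (LinearMap.pushoutProj π φ.hom) LinearMap.id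
    (LinearMap.pushoutProj_surjective π φ.hom hπ)
  obtain ⟨ψ, hψ⟩ := LinearMap.exists_extend_of_pushoutProj_section π φ.hom s hs
  have hφ : φ = ModuleCat.ofHom (LinearMap.ker π).subtype ≫ ModuleCat.ofHom ψ :=
    ModuleCat.hom_ext hψ.symm
  rw [hφ, ← Abelian.Ext.mk₀_comp_mk₀, ← Abelian.Ext.comp_assoc _ _ _ (add_zero 1) (zero_add 0) (by simp)]
  have := hS.extClass_comp
  dsimp only at this
  rw [this, Abelian.Ext.zero_comp]

/-- This removes Ext from the rest of the argument. An Ext-projective `Q` is a summand of a power of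
`P` because a surjection `P^n → Q` splits, and there are enough Ext-projectives because the kernel
of `P^n → X` stays in `W`. -/
theorem IsWide.isExtProgenerator_iff (hW : IsWide W) {P : RMod Λ} :
    IsExtProgenerator W P ↔ W P ∧ IsRelProjective W P ∧ IsGenerator W P := by
  constructor
  · rintro ⟨hPW, hadd, hen⟩
    refine ⟨hPW, hW.isRelProjective_of_extProjectives ?_, ?_⟩
    · rw [← hadd]
      exact ⟨1, ⟨{
        i := FGModuleCat.ofHom (V := P) (LinearMap.pi fun _ : Fin 1 => LinearMap.id)
        r := FGModuleCat.ofHom (W := P) (LinearMap.proj (0 : Fin 1))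
        retract := rfl }⟩⟩
    · intro M _ _ _ hM
      obtain ⟨Y, Q, f, g, w, -, hQ, hS⟩ := hen _ hM
      rw [← hadd] at hQ
      obtain ⟨n, ⟨ρ⟩⟩ := hQ
      have h1 : Function.Surjective ρ.r.hom.hom := fun x =>
        ⟨ρ.i.hom.hom x, congr(($(ρ.retract)).hom.hom x)⟩
      have h2 := (FGModuleCat.epi_iff_surjective g).1 hS.epi_g
      exact ⟨n, g.hom.hom ∘ₗ ρ.r.hom.hom, h2.comp h1⟩
  · rintro ⟨hPW, hP, hgen⟩
    have hpow : ∀ n, extProjectives W (FGModuleCat.of Λᵐᵒᵖ (Fin n → P)) := fun n =>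
      hW.extProjectives_of_isRelProjective (hW.contains_pi n hPW) (hP.pi n)
    refine ⟨hPW, ?_, fun X hX => ?_⟩
    · ext Q
      constructor
      · rintro ⟨n, ⟨ρ⟩⟩
        have := hW.directSummand
        exact hW.extProjectives_of_isRelProjective (W.prop_of_retract ρ (hpow n).1)
          ((hP.pi n).of_retract ρ.i.hom.hom ρ.r.hom.hom congr(($(ρ.retract)).hom.hom))
      · intro hQ
        obtain ⟨n, p, hp⟩ := hgen (M := Q) hQ.1
        obtain ⟨s, hs⟩ := hW.isRelProjective_of_extProjectives hQ (hpow n).1 hQ.1 p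
          LinearMap.id hp
        exact ⟨n, ⟨{
          i := FGModuleCat.ofHom (V := Q) s
          r := FGModuleCat.ofHom (W := Q) p
          retract := by ext x; exact congr($hs x) }⟩⟩
    · obtain ⟨n, p, hp⟩ := hgen (M := X) hX
      obtain ⟨w, hS⟩ := FGModuleCat.shortExact_of_linearMap (LinearMap.ker p).subtype p
        (Submodule.subtype_injective _) hp (Submodule.range_subtype _)
      exact ⟨_, _, _, _, w, hW.contains_ker p (hpow n).1 hX, hpow n, hS⟩

end RMod

/-! ### Finite generation over the base ring, expressed through endomorphisms. -/

section LinearAlgebra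

theorem LinearMap.exists_comp_eq_of_ker_le {A M N K : Type*} [Ring A] [AddCommGroup M]
    [Module A M] [AddCommGroup N] [Module A N] [AddCommGroup K] [Module A K]
    (p : M →ₗ[A] N) (hp : Function.Surjective p) (g : M →ₗ[A] K)
    (h : LinearMap.ker p ≤ LinearMap.ker g) : ∃ k : N →ₗ[A] K, k ∘ₗ p = g := by
  refine ⟨(LinearMap.ker p).liftQ g h ∘ₗ (p.quotKerEquivOfSurjective hp).symm.toLinearMap, ?_⟩
  ext x
  have : (p.quotKerEquivOfSurjective hp).symm (p x) = Submodule.Quotient.mk x :=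
    (LinearEquiv.symm_apply_eq _).2 rfl
  simp [this]

theorem LinearMap.exists_eq_of_apply_single {A ι M N : Type*} [Ring A] [Fintype ι]
    [DecidableEq ι] [AddCommGroup M] [Module A M] [AddCommGroup N] [Module A N]
    (f : ι → M →ₗ[A] N) :
    ∃ h : (ι → M) →ₗ[A] N, (∀ x, h x = ∑ i, f i (x i)) ∧
      ∀ i, h ∘ₗ LinearMap.single A (fun _ => M) i = f i := by
  refine ⟨LinearMap.lsum A (fun _ => M) ℕ f, fun x => by simp, fun i => ?_⟩
  ext x
  rw [LinearMap.comp_apply, LinearMap.lsum_apply, LinearMap.sum_apply,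
    Finset.sum_eq_single i] <;> simp +contextual

/-- For `Q = P` the right-hand factors are endomorphisms of `P`, so `p ∘ g` becomes a combination
over `End P` of the components of `p`. -/
theorem LinearMap.eq_sum_single_comp {A Q P X : Type*} [Ring A] [AddCommGroup P] [Module A P]
    [AddCommGroup Q] [Module A Q] [AddCommGroup X] [Module A X] {n : ℕ}
    (p : (Fin n → P) →ₗ[A] X) (g : Q →ₗ[A] (Fin n → P)) :
    p ∘ₗ g = ∑ i, (p ∘ₗ LinearMap.single A (fun _ => P) i) ∘ₗ (LinearMap.proj i ∘ₗ g) := by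
  ext x
  simp only [LinearMap.comp_apply, LinearMap.sum_apply, ← map_sum]
  congr 1
  exact (LinearMap.sum_single_apply (fun _ => P) (g x)).symm

/-- A finitely generated module over an artin algebra is generated by finitely many elements
under its scalar endomorphisms. -/
theorem Module.exists_generators_under_endomorphisms (R : Type v) {A : Type u} [CommRing R] [Ring A]
    [Algebra R A] [IsArtinianRing R] [Module.Finite R A] (M : Type*) [AddCommGroup M] [Module A M]
    [Module.Finite A M] : ∃ (k : ℕ) (c : Fin k → M),
      ∀ m, ∃ r : Fin k → Module.End A M, ∑ i, r i (c i) = m := by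
  -- The `R`-structure stays local to the proof: in the conclusion, scalars appear as the
  -- endomorphisms `r • id`.
  let : Module R M := Module.compHom _ (algebraMap R A)
  have : IsScalarTower R A M := ⟨fun r a x => by
    rw [Algebra.smul_def, mul_smul]; rfl⟩
  have : SMulCommClass A R M := ⟨fun a r x => by
    change a • algebraMap R A r • x = algebraMap R A r • a • x
    rw [smul_smul, smul_smul, Algebra.commutes]⟩
  have : Module.Finite R M := Module.Finite.trans A M
  obtain ⟨k, c, hc⟩ := Module.Finite.exists_fin (R := R) (M := M)
  refine ⟨k, c, fun m => ?_⟩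
  obtain ⟨r, hr⟩ := (Submodule.mem_span_range_iff_exists_fun R).1 (hc ▸ Submodule.mem_top : m ∈ _)
  exact ⟨fun i => r i • LinearMap.id, by simpa using hr⟩

/-- The homomorphisms between two finitely generated modules over an artin algebra are generated
by finitely many of them under scalar endomorphisms of the source, or of the target. -/
theorem LinearMap.exists_generators_under_endomorphisms (R : Type v) {A : Type u} [CommRing R] [Ring A]
    [Algebra R A] [IsArtinianRing R] [Module.Finite R A] (M N : Type*) [AddCommGroup M]
    [Module A M] [Module.Finite A M] [AddCommGroup N] [Module A N] [Module.Finite A N] :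
    ∃ (k : ℕ) (c : Fin k → M →ₗ[A] N), ∀ f,
      (∃ r : Fin k → Module.End A M, ∑ i, c i ∘ₗ r i = f) ∧
      (∃ r : Fin k → Module.End A N, ∑ i, r i ∘ₗ c i = f) := by
  let : Module R M := Module.compHom _ (algebraMap R A)
  have : SMulCommClass A R M := ⟨fun a r x => by
    change a • algebraMap R A r • x = algebraMap R A r • a • x
    rw [smul_smul, smul_smul, Algebra.commutes]⟩
  let : Module R N := Module.compHom _ (algebraMap R A)
  have : IsScalarTower R A N := ⟨fun r a x => by
    rw [Algebra.smul_def, mul_smul]; rfl⟩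
  have : SMulCommClass A R N := ⟨fun a r x => by
    change a • algebraMap R A r • x = algebraMap R A r • a • x
    rw [smul_smul, smul_smul, Algebra.commutes]⟩
  have : IsNoetherian R (M →ₗ[A] N) := LinearMap.isNoetherian_of_finite
  obtain ⟨k, c, hc⟩ := Module.Finite.exists_fin (R := R) (M := M →ₗ[A] N)
  refine ⟨k, c, fun f => ?_⟩
  obtain ⟨r, hr⟩ := (Submodule.mem_span_range_iff_exists_fun R).1 (hc ▸ Submodule.mem_top : f ∈ _)
  refine ⟨⟨fun i => r i • LinearMap.id, ?_⟩, ⟨fun i => r i • LinearMap.id, ?_⟩⟩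
  · rw [← hr]
    refine Finset.sum_congr rfl fun i _ => ?_
    ext x
    exact (c i).map_smul (algebraMap R A (r i)) x
  · rw [← hr]
    rfl

end LinearAlgebra

/-! ### Universal elements, approximations and progenerators. -/

namespace RMod

variable {Λ : Type u} [Ring Λ] {W : ObjectProperty (RMod Λ)}

/-- `z` is universal among the elements of modules in `W`: the map `1 ↦ z` is a left
`W`-approximation of the regular module. -/
def IsUniversalElement (W : ObjectProperty (RMod Λ)) {Z : Type u} [AddCommGroup Z]
    [Module Λᵐᵒᵖ Z] (z : Z) : Prop :=
  ∀ ⦃M : Type u⦄ [AddCommGroup M] [Module Λᵐᵒᵖ M] [Module.Finite Λᵐᵒᵖ M], Contains W M →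
    ∀ m : M, ∃ h : Z →ₗ[Λᵐᵒᵖ] M, h z = m

theorem IsCovariantlyFinite.exists_isUniversalElement (h : IsCovariantlyFinite W) :
    ∃ (Z : RMod Λ) (z : Z), W Z ∧ IsUniversalElement W z := by
  obtain ⟨Z, f, hZ, hf⟩ := h (FGModuleCat.of Λᵐᵒᵖ Λᵐᵒᵖ)
  refine ⟨Z, f.hom.hom (1 : Λᵐᵒᵖ), hZ, fun M _ _ _ hM m => ?_⟩
  obtain ⟨h, hh⟩ := hf _ (FGModuleCat.ofHom (LinearMap.toSpanSingleton Λᵐᵒᵖ M m)) hM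
  exact ⟨h.hom.hom, congr(($hh).hom.hom (1 : Λᵐᵒᵖ)).trans (one_smul _ m)⟩

theorem IsUniversalElement.codRestrict {Z : Type u} [AddCommGroup Z] [Module Λᵐᵒᵖ Z] {z : Z}
    (h : IsUniversalElement W z) (D : Submodule Λᵐᵒᵖ Z) (hz : z ∈ D) :
    IsUniversalElement W (⟨z, hz⟩ : D) := fun M _ _ _ hM m => by
  obtain ⟨g, hg⟩ := h hM m
  exact ⟨g ∘ₗ D.subtype, hg⟩

namespace IsWide

variable [IsArtinianRing Λᵐᵒᵖ]

/-- Present `X` as a quotient of a free module of rank `n` and send each basis vector to `z` in its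
own copy of `Z`. Dividing `Z^n` by the smallest `W`-submodule containing the image of the relations
gives the approximation: any map from `Z^n` into `W` killing that image has its kernel in `W`, so it
kills this submodule too. -/
theorem isCovariantlyFinite_of_isUniversalElement (hW : IsWide W) {Z : RMod Λ} {z : Z} (hZ : W Z)
    (hz : IsUniversalElement W z) : IsCovariantlyFinite W := by
  intro X
  obtain ⟨n, π, hπ⟩ := Module.Finite.exists_fin' Λᵐᵒᵖ X
  let f : (Fin n → Λᵐᵒᵖ) →ₗ[Λᵐᵒᵖ] (Fin n → Z) :=
    LinearMap.pi fun i => LinearMap.toSpanSingleton Λᵐᵒᵖ Z z ∘ₗ LinearMap.proj i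
  have hZn := hW.contains_pi n hZ
  obtain ⟨D, hD, hle, hmin⟩ := hW.exists_least_submodule hZn
    ((LinearMap.ker π).map f : Submodule Λᵐᵒᵖ (Fin n → Z))
  obtain ⟨k, hk⟩ := LinearMap.exists_comp_eq_of_ker_le π hπ (D.mkQ ∘ₗ f) fun x hx =>
    (Submodule.Quotient.mk_eq_zero D).2 (hle (Submodule.mem_map_of_mem hx))
  refine ⟨FGModuleCat.of Λᵐᵒᵖ ((Fin n → Z) ⧸ D), FGModuleCat.ofHom (V := X) k,
    hW.contains_quotient D hZn hD, fun M g hM => ?_⟩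
  choose t ht using fun i : Fin n => hz (M := M) hM (g.hom.hom (π (Pi.single i 1)))
  obtain ⟨h, -, hh⟩ := LinearMap.exists_eq_of_apply_single t
  have hfg : h ∘ₗ f = g.hom.hom ∘ₗ π := by
    refine LinearMap.pi_ext' fun i => LinearMap.ext_ring ?_
    have : f (Pi.single i 1) = Pi.single i z := by
      ext j
      by_cases hij : j = i
      · subst hij; simp [f]
      · simp [f, hij]
    refine Eq.trans ?_ (ht i)
    rw [← hh i]
    exact congrArg h this
  have hDle : D ≤ LinearMap.ker h := by
    refine hmin _ (hW.contains_ker h hZn hM) ?_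
    rintro _ ⟨x, hx, rfl⟩
    have : h (f x) = g.hom.hom (π x) := congr($hfg x)
    change h (f x) = 0
    rw [this, LinearMap.mem_ker.1 hx, map_zero]
  refine ⟨FGModuleCat.ofHom (W := M) (D.liftQ h hDle), ?_⟩
  ext x
  obtain ⟨y, rfl⟩ := hπ x
  have h1 : k (π y) = D.mkQ (f y) := congr($hk y)
  have h2 : h (f y) = g.hom.hom (π y) := congr($hfg y)
  change D.liftQ h hDle (k (π y)) = _
  rw [h1, ← h2]
  rfl

/-- The `W`-submodule generated by a universal element is a progenerator. -/
theorem exists_progenerator_of_isUniversalElement (hW : IsWide W) {Z : RMod Λ} {z : Z} (hZ : W Z)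
    (hz : IsUniversalElement W z) :
    ∃ P : RMod Λ, W P ∧ IsRelProjective W P ∧ IsGenerator W P := by
  obtain ⟨D, hD, hle, hmin⟩ := hW.exists_least_submodule (M := Z) hZ {z}
  have hzD : z ∈ D := hle rfl
  have huniv := hz.codRestrict D hzD
  refine ⟨FGModuleCat.of Λᵐᵒᵖ D, hD, ?_, ?_⟩
  · intro M N _ _ _ _ _ _ hM hN p g hp
    obtain ⟨m, hm⟩ := hp (g ⟨z, hzD⟩)
    obtain ⟨h, hh⟩ := huniv hM m
    refine ⟨h, ?_⟩
    -- The locus where `p ∘ h` and `g` agree is a `W`-submodule containing `z`; by minimality it is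
    -- all of `D`.
    have hK := hW.contains_map D.subtype _ (hW.contains_ker (p ∘ₗ h - g) hD hN) hZ
    have := hmin _ hK (by
      rw [Set.singleton_subset_iff]
      exact ⟨⟨z, hzD⟩, by simp [hh, hm], rfl⟩)
    ext x
    obtain ⟨y, hy, hyx⟩ := this x.2
    have : y = x := Subtype.ext hyx
    subst this
    exact sub_eq_zero.1 hy
  · intro M _ _ _ hM
    obtain ⟨n, s, hs⟩ := Module.Finite.exists_fin (R := Λᵐᵒᵖ) (M := M)
    choose t ht using fun i => huniv hM (s i)
    obtain ⟨h, -, hh⟩ := LinearMap.exists_eq_of_apply_single t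
    refine ⟨n, h, LinearMap.range_eq_top.1 (top_le_iff.1 (hs ▸ Submodule.span_le.2 ?_))⟩
    rintro _ ⟨i, rfl⟩
    exact ⟨Pi.single i ⟨z, hzD⟩, (congr($(hh i) ⟨z, hzD⟩)).trans (ht i)⟩

/-- The universal element is a tuple `c` of `R`-generators of `P`: matrices of scalars carry it to
any element of `P^n`, and `P^n` covers any module of `W`. -/
theorem exists_isUniversalElement_of_isGenerator (R : Type v) [CommRing R] [IsArtinianRing R]
    [Algebra R Λᵐᵒᵖ] [Module.Finite R Λᵐᵒᵖ] (hW : IsWide W) {P : RMod Λ} (hPW : W P)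
    (hgen : IsGenerator W P) : ∃ (Z : RMod Λ) (z : Z), W Z ∧ IsUniversalElement W z := by
  obtain ⟨k, c, hc⟩ := Module.exists_generators_under_endomorphisms R (A := Λᵐᵒᵖ) P
  refine ⟨FGModuleCat.of Λᵐᵒᵖ (Fin k → P), c, hW.contains_pi k hPW, fun M _ _ _ hM m => ?_⟩
  obtain ⟨n, p, hp⟩ := hgen hM
  obtain ⟨x, rfl⟩ := hp m
  choose r hr using fun j => hc (x j)
  choose h hh _ using fun j => LinearMap.exists_eq_of_apply_single (r j)
  refine ⟨p ∘ₗ LinearMap.pi h, congrArg p ?_⟩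
  ext j
  exact (hh j c).trans (hr j)

/-- Generators of `Hom(P, X)` assemble to `g : P^k → X`, through which every map `P^n → X` factors.
For `p : P^n → M` onto and `f : M → X`, a lift `U` of `f ∘ p` sends `ker p` to a `W`-submodule of
`ker g`. Dividing by the largest such submodule lets the lift descend to `M`. -/
theorem isContravariantlyFinite_of_progenerator (R : Type v) [CommRing R] [IsArtinianRing R]
    [Algebra R Λᵐᵒᵖ] [Module.Finite R Λᵐᵒᵖ] (hW : IsWide W) {P : RMod Λ} (hPW : W P)
    (hgen : IsGenerator W P) : IsContravariantlyFinite W := by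
  intro X
  obtain ⟨k, c, hc⟩ := LinearMap.exists_generators_under_endomorphisms R (A := Λᵐᵒᵖ) P X
  obtain ⟨g, hg, -⟩ := LinearMap.exists_eq_of_apply_single c
  have hPk := hW.contains_pi k hPW
  obtain ⟨D, hD, hle, hmax⟩ := hW.exists_greatest_submodule hPk (LinearMap.ker g)
  refine ⟨FGModuleCat.of Λᵐᵒᵖ ((Fin k → P) ⧸ D), FGModuleCat.ofHom (W := X) (D.liftQ g hle),
    hW.contains_quotient D hPk hD, fun M f hM => ?_⟩
  obtain ⟨n, p, hp⟩ := hgen (M := M) hM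
  have hPn := hW.contains_pi n hPW
  -- lift `f ∘ p` along `g`, componentwise
  have hu : ∀ i : Fin n, ∃ u : P →ₗ[Λᵐᵒᵖ] (Fin k → P),
      g ∘ₗ u = f.hom.hom ∘ₗ p ∘ₗ LinearMap.single Λᵐᵒᵖ (fun _ => P) i := fun i => by
    obtain ⟨⟨r, hr⟩, -⟩ := hc (f.hom.hom ∘ₗ p ∘ₗ LinearMap.single Λᵐᵒᵖ (fun _ => P) i)
    refine ⟨LinearMap.pi r, ?_⟩
    rw [← hr]
    ext x
    simp [hg]
  choose u hu using hu
  obtain ⟨U, -, hU⟩ := LinearMap.exists_eq_of_apply_single u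
  have hgU : g ∘ₗ U = f.hom.hom ∘ₗ p := LinearMap.pi_ext' fun i => by
    rw [LinearMap.comp_assoc, hU, hu, LinearMap.comp_assoc]
  have hker : (LinearMap.ker p).map U ≤ D := by
    refine hmax _ (hW.contains_map U _ (hW.contains_ker p hPn hM) hPk) ?_
    rintro _ ⟨x, hx, rfl⟩
    have : g (U x) = f.hom.hom (p x) := congr($hgU x)
    rw [LinearMap.mem_ker, this, LinearMap.mem_ker.1 hx, map_zero]
  obtain ⟨h, hh⟩ := LinearMap.exists_comp_eq_of_ker_le p hp (D.mkQ ∘ₗ U) fun x hx =>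
    (Submodule.Quotient.mk_eq_zero D).2 (hker (Submodule.mem_map_of_mem hx))
  refine ⟨FGModuleCat.ofHom (V := M) h, ?_⟩
  ext x
  obtain ⟨y, rfl⟩ := hp x
  have h1 : h (p y) = D.mkQ (U y) := congr($hh y)
  have h2 : g (U y) = f.hom.hom (p y) := congr($hgU y)
  change D.liftQ g hle (h (p y)) = _
  rw [h1, ← h2]
  rfl

/-- A contravariantly finite wide subcategory has a cogenerator, and the submodule of a power of
it generated in `W` by a tuple of scalar generators provides a universal element. -/
theorem exists_isUniversalElement_of_isContravariantlyFinite (R : Type v) [CommRing R]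
    [IsArtinianRing R] [Algebra R Λᵐᵒᵖ] [Module.Finite R Λᵐᵒᵖ] (hW : IsWide W)
    (h : IsContravariantlyFinite W) :
    ∃ (Z : RMod Λ) (z : Z), W Z ∧ IsUniversalElement W z := by
  obtain ⟨Q, _, _, _, hQ⟩ := Module.exists_finite_cogenerator R Λᵐᵒᵖ
  obtain ⟨I, a, hI, ha⟩ := h (FGModuleCat.of Λᵐᵒᵖ Q)
  -- Maps from `M` to the cogenerator `Q` factor through the approximation `a`, so `I` cogenerates
  -- `W`.
  have hcog : ∀ (M : Type u) [AddCommGroup M] [Module Λᵐᵒᵖ M] [Module.Finite Λᵐᵒᵖ M],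
      Contains W M → ∀ x : M, (∀ f : M →ₗ[Λᵐᵒᵖ] I, f x = 0) → x = 0 := by
    intro M _ _ _ hM x hx
    by_contra hne
    obtain ⟨f, hf⟩ := hQ M x hne
    obtain ⟨g, hg⟩ := ha _ (FGModuleCat.ofHom f) hM
    refine hf ?_
    have h1 : a.hom.hom (g.hom.hom x) = f x := congr(($hg).hom.hom x)
    rw [← h1, hx g.hom.hom, map_zero]
  obtain ⟨k, c, hc⟩ := Module.exists_generators_under_endomorphisms R (A := Λᵐᵒᵖ) I
  have hIk := hW.contains_pi k hI
  obtain ⟨D, hD, hle, hmin⟩ := hW.exists_least_submodule hIk {c}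
  refine ⟨FGModuleCat.of Λᵐᵒᵖ D, ⟨c, hle rfl⟩, hD, fun M _ _ _ hM m => ?_⟩
  obtain ⟨l, d, hd⟩ := LinearMap.exists_generators_under_endomorphisms R (A := Λᵐᵒᵖ) M I
  have hIl := hW.contains_pi l hI
  -- Every map `M → I` is a combination of the `d i`, so an element killed by all `d i` is killed by
  -- all maps to `I`.
  have hinj : Function.Injective (LinearMap.pi d) := by
    rw [injective_iff_map_eq_zero]
    intro x hx
    refine hcog M hM x fun f => ?_
    obtain ⟨-, r, rfl⟩ := hd f
    have : ∀ i, d i x = 0 := fun i => congr_fun hx i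
    simp [this]
  choose r hr using fun j => hc (d j m)
  choose s hs _ using fun j => LinearMap.exists_eq_of_apply_single (r j)
  have hsc : LinearMap.pi s c = LinearMap.pi d m := by
    ext j
    exact (hs j c).trans (hr j)
  -- The scalar matrix `s` sends `c` to the image of `m` in `I^l`. The preimage under `s` of the
  -- embedded copy of `M` is thus a `W`-submodule containing `c`, hence contains `D`.
  have hDle : D ≤ (LinearMap.range (LinearMap.pi d)).comap (LinearMap.pi s) := by
    refine hmin _ (hW.contains_comap _ _ hIk hIl (hW.contains_range _ hM hIl)) ?_
    rw [Set.singleton_subset_iff]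
    exact ⟨m, hsc.symm⟩
  let e := LinearEquiv.ofInjective (LinearMap.pi d) hinj
  refine ⟨e.symm.toLinearMap ∘ₗ (LinearMap.pi s).restrict hDle, ?_⟩
  exact (LinearEquiv.symm_apply_eq e).2 (Subtype.ext hsc)

end IsWide
end RMod

/-! ### The equivalence `Hom(P, -)` with modules over the endomorphism ring. -/

section EndModule

variable {A P X Y : Type*} [Ring A] [AddCommGroup P] [Module A P] [AddCommGroup X] [Module A X]
  [AddCommGroup Y] [Module A Y]

/-- The homomorphisms out of `P` form a right module over the endomorphism ring of `P`. -/
@[reducible]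
def LinearMap.rightEndModule : Module (Module.End A P)ᵐᵒᵖ (P →ₗ[A] X) where
  smul γ f := f ∘ₗ γ.unop
  one_smul _ := rfl
  mul_smul _ _ _ := rfl
  smul_zero _ := rfl
  smul_add _ _ _ := rfl
  add_smul _ _ f := LinearMap.comp_add _ _ f
  zero_smul f := LinearMap.comp_zero f

attribute [local instance] LinearMap.rightEndModule

/-- Composition with a linear map, as a homomorphism of right modules over `End P`. -/
def LinearMap.postcomp (f : X →ₗ[A] Y) :
    (P →ₗ[A] X) →ₗ[(Module.End A P)ᵐᵒᵖ] (P →ₗ[A] Y) where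
  toFun g := f ∘ₗ g
  map_add' _ _ := LinearMap.comp_add _ _ f
  map_smul' _ _ := rfl

theorem LinearMap.rightEndModule_finite (R : Type v) {A : Type u} {P X : Type*} [CommRing R]
    [Ring A] [Algebra R A] [IsArtinianRing R] [Module.Finite R A] [AddCommGroup P] [Module A P]
    [Module.Finite A P] [AddCommGroup X] [Module A X] [Module.Finite A X] :
    Module.Finite (Module.End A P)ᵐᵒᵖ (P →ₗ[A] X) := by
  obtain ⟨k, c, hc⟩ := LinearMap.exists_generators_under_endomorphisms R (A := A) P X
  refine ⟨Submodule.fg_iff_exists_fin_generating_family.2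
    ⟨k, c, top_le_iff.1 fun f _ => ?_⟩⟩
  obtain ⟨⟨r, rfl⟩, -⟩ := hc f
  exact Submodule.sum_mem _ fun i _ =>
    Submodule.smul_mem _ (MulOpposite.op (r i)) (Submodule.subset_span ⟨i, rfl⟩)

end EndModule

/-- The endomorphism ring of a finitely generated module over an artin algebra is an artin algebra
over its center. -/
theorem Module.End.isArtinAlgebra (R : Type v) {A : Type u} {P : Type u} [CommRing R]
    [Ring A] [Algebra R A] [IsArtinianRing R] [Module.Finite R A] [AddCommGroup P] [Module A P]
    [Module.Finite A P] :
    ∃ (S : Type u) (_ : CommRing S) (_ : Algebra S (Module.End A P)),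
      IsArtinAlgebra S (Module.End A P) ∧ IsNoetherianRing (Module.End A P)ᵐᵒᵖ := by
  let : Module R P := Module.compHom _ (algebraMap R A)
  have : IsScalarTower R A P := ⟨fun r a x => by
    rw [Algebra.smul_def, mul_smul]; rfl⟩
  have : SMulCommClass A R P := ⟨fun a r x => by
    change a • algebraMap R A r • x = algebraMap R A r • a • x
    rw [smul_smul, smul_smul, Algebra.commutes]⟩
  have : IsNoetherian R (Module.End A P) := LinearMap.isNoetherian_of_finite
  -- The center serves as base ring because it lives in the universe `u` of `P`, whereas `R` lives
  -- in `v`. It is finite over `R` as a submodule of the noetherian module `End P`.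
  let : Algebra R (Subring.center (Module.End A P)) :=
    ((algebraMap R (Module.End A P)).codRestrict (Subring.center _) fun r =>
      Subring.mem_center_iff.2 fun x => (Algebra.commutes r x).symm).toAlgebra
  have : IsScalarTower R (Subring.center (Module.End A P)) (Module.End A P) :=
    IsScalarTower.of_algebraMap_eq fun _ => rfl
  have : Module.Finite R (Subring.center (Module.End A P)) :=
    Module.Finite.of_injective (IsScalarTower.toAlgHom R _ (Module.End A P)).toLinearMap
      Subtype.val_injective
  refine ⟨Subring.center (Module.End A P), inferInstance, inferInstance,
    ⟨IsArtinianRing.of_finite R _, Module.Finite.of_restrictScalars_finite R _ _⟩, ?_⟩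
  have : Module.Finite R (Module.End A P)ᵐᵒᵖ :=
    Module.Finite.equiv (MulOpposite.opLinearEquiv R)
  exact IsNoetherianRing.of_finite R _

namespace RMod

variable {Λ : Type u} [Ring Λ] {W : ObjectProperty (RMod Λ)}

attribute [local instance] LinearMap.rightEndModule

/-- The functor `Hom(P, -)` from `W` to the right modules over `End P`. -/
def homFunctor (W : ObjectProperty (RMod Λ)) (P : RMod Λ)
    (hfin : ∀ X : RMod Λ, Module.Finite (Module.End Λᵐᵒᵖ P)ᵐᵒᵖ (P →ₗ[Λᵐᵒᵖ] X)) :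
    W.FullSubcategory ⥤ RMod (Module.End Λᵐᵒᵖ P) where
  obj X := have := hfin X.obj
    FGModuleCat.of (Module.End Λᵐᵒᵖ P)ᵐᵒᵖ (P →ₗ[Λᵐᵒᵖ] X.obj)
  map {X Y} f := have := hfin X.obj; have := hfin Y.obj
    FGModuleCat.ofHom f.hom.hom.hom.postcomp

variable {P : RMod Λ}

theorem homFunctor_faithful
    (hfin : ∀ X : RMod Λ, Module.Finite (Module.End Λᵐᵒᵖ P)ᵐᵒᵖ (P →ₗ[Λᵐᵒᵖ] X))
    (hgen : IsGenerator W P) : (homFunctor W P hfin).Faithful where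
  map_injective {X Y f g} hfg := by
    obtain ⟨n, p, hp⟩ := hgen (M := X.obj) X.property
    ext x
    obtain ⟨y, rfl⟩ := hp x
    have : f.hom.hom.hom ∘ₗ p = g.hom.hom.hom ∘ₗ p := by
      refine LinearMap.pi_ext' fun i => ?_
      exact congr(($hfg).hom.hom (p ∘ₗ LinearMap.single Λᵐᵒᵖ (fun _ => P) i))
    exact congr($this y)

variable [IsNoetherianRing Λᵐᵒᵖ]

/-- The values of `φ` on the components of `p : P^n → X` define `h : P^n → Y`. Linearity over `End
P` gives `h ∘ g = φ (p ∘ g)` for all `g : P → P^n`. As `ker p` is covered by a power of `P`, `h`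
kills it and descends to `X`; lifting maps `P → X` along `p` shows that the descended map induces
`φ`. -/
theorem IsWide.homFunctor_full (hW : IsWide W) (hPW : W P)
    (hfin : ∀ X : RMod Λ, Module.Finite (Module.End Λᵐᵒᵖ P)ᵐᵒᵖ (P →ₗ[Λᵐᵒᵖ] X))
    (hP : IsRelProjective W P) (hgen : IsGenerator W P) : (homFunctor W P hfin).Full where
  map_surjective {X Y} φ := by
    let φ' : (P →ₗ[Λᵐᵒᵖ] X.obj) →ₗ[(Module.End Λᵐᵒᵖ P)ᵐᵒᵖ] (P →ₗ[Λᵐᵒᵖ] Y.obj) := φ.hom.hom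
    obtain ⟨n, p, hp⟩ := hgen (M := X.obj) X.property
    have hPn := hW.contains_pi n hPW
    obtain ⟨h, hh, -⟩ := LinearMap.exists_eq_of_apply_single fun i =>
      φ' (p ∘ₗ LinearMap.single Λᵐᵒᵖ (fun _ => P) i)
    have key : ∀ g : P →ₗ[Λᵐᵒᵖ] (Fin n → P), h ∘ₗ g = φ' (p ∘ₗ g) := fun g => by
      rw [LinearMap.eq_sum_single_comp p g, map_sum]
      ext x
      simp only [LinearMap.comp_apply, hh, LinearMap.sum_apply]
      refine Finset.sum_congr rfl fun i _ => ?_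
      exact congr($((φ'.map_smul (MulOpposite.op (LinearMap.proj i ∘ₗ g))
        (p ∘ₗ LinearMap.single Λᵐᵒᵖ (fun _ => P) i)).symm) x)
    obtain ⟨m, q, hq⟩ := hgen (hW.contains_ker p hPn X.property)
    have hq0 : h ∘ₗ (LinearMap.ker p).subtype ∘ₗ q = 0 := LinearMap.pi_ext' fun j => by
      refine (key ((LinearMap.ker p).subtype ∘ₗ q ∘ₗ LinearMap.single Λᵐᵒᵖ (fun _ => P) j)).trans ?_
      rw [← LinearMap.comp_assoc, LinearMap.comp_ker_subtype, LinearMap.zero_comp, map_zero]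
      rfl
    obtain ⟨k, hk⟩ := LinearMap.exists_comp_eq_of_ker_le p hp h fun x hx => by
      obtain ⟨y, hy⟩ := hq ⟨x, hx⟩
      have : h (q y).1 = 0 := congr($hq0 y)
      rwa [hy] at this
    refine ⟨ObjectProperty.homMk (FGModuleCat.ofHom (V := X.obj) (W := Y.obj) k), ?_⟩
    ext g : 2
    obtain ⟨g', hg'⟩ := hP hPn X.property p g hp
    change k ∘ₗ g = φ' g
    rw [← hg', ← key, ← hk, LinearMap.comp_assoc]

/-- A finite presentation of `N` over `End P` is realised by a map `U : P^m → P^n`. Its cokernel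
lies in `W`, and relative projectivity makes `Hom(P, -)` exact enough to recover `N` from that
cokernel. -/
theorem IsWide.homFunctor_essSurj (hW : IsWide W) (hPW : W P)
    [IsNoetherianRing (Module.End Λᵐᵒᵖ P)ᵐᵒᵖ]
    (hfin : ∀ X : RMod Λ, Module.Finite (Module.End Λᵐᵒᵖ P)ᵐᵒᵖ (P →ₗ[Λᵐᵒᵖ] X))
    (hP : IsRelProjective W P) : (homFunctor W P hfin).EssSurj where
  mem_essImage N := by
    obtain ⟨n, s, hs⟩ := Module.Finite.exists_fin (R := (Module.End Λᵐᵒᵖ P)ᵐᵒᵖ) (M := N)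
    have hPn := hW.contains_pi n hPW
    have := hfin (FGModuleCat.of Λᵐᵒᵖ (Fin n → P))
    let π : (P →ₗ[Λᵐᵒᵖ] (Fin n → P)) →ₗ[(Module.End Λᵐᵒᵖ P)ᵐᵒᵖ] N :=
      { toFun := fun u => ∑ i, MulOpposite.op (LinearMap.proj i ∘ₗ u) • s i
        map_add' := fun u v => by
          rw [← Finset.sum_add_distrib]
          refine Finset.sum_congr rfl fun i _ => ?_
          rw [LinearMap.comp_add, MulOpposite.op_add, add_smul]
        map_smul' := fun γ u => by
          rw [Finset.smul_sum]
          refine Finset.sum_congr rfl fun i _ => ?_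
          rw [smul_smul]
          rfl }
    have hπ : Function.Surjective π := fun y => by
      obtain ⟨c, rfl⟩ := (Submodule.mem_span_range_iff_exists_fun _).1
        (hs ▸ Submodule.mem_top : y ∈ _)
      exact ⟨LinearMap.pi fun i => (c i).unop, rfl⟩
    obtain ⟨m, u, hu⟩ := Module.Finite.exists_fin (R := (Module.End Λᵐᵒᵖ P)ᵐᵒᵖ)
      (M := LinearMap.ker π)
    have hPm := hW.contains_pi m hPW
    obtain ⟨U, hU, hU'⟩ := LinearMap.exists_eq_of_apply_single fun j => (u j).1
    have hX := hW.contains_quotient _ hPn (hW.contains_range U hPm hPn)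
    let q := (LinearMap.range U).mkQ
    let ρ : (P →ₗ[Λᵐᵒᵖ] (Fin n → P)) →ₗ[(Module.End Λᵐᵒᵖ P)ᵐᵒᵖ]
      (P →ₗ[Λᵐᵒᵖ] ((Fin n → P) ⧸ LinearMap.range U)) := q.postcomp
    have hρ : Function.Surjective ρ := fun g =>
      hP hPn hX q g (Submodule.mkQ_surjective _)
    -- A map `P → P^n` is killed by `ρ` when it lands in the range of `U`. It then lifts through
    -- `U`, so it is an `End P`-combination of the chosen generators `u j` of `ker π`.
    have hker : LinearMap.ker ρ = LinearMap.ker π := by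
      refine le_antisymm (fun g hg => ?_) (fun g hg => ?_)
      · have hgr : ∀ x, g x ∈ LinearMap.range U := fun x =>
          (Submodule.Quotient.mk_eq_zero _).1 congr($(LinearMap.mem_ker.1 hg) x)
        obtain ⟨t, ht⟩ := hP hPm (hW.contains_range U hPm hPn) U.rangeRestrict
          (g.codRestrict _ hgr) U.surjective_rangeRestrict
        have hgt : g = U ∘ₗ t := by
          ext x : 1
          exact congr(($ht x).1).symm
        rw [hgt, LinearMap.eq_sum_single_comp]
        refine Submodule.sum_mem _ fun j _ => ?_
        rw [hU' j]
        exact Submodule.smul_mem _ (MulOpposite.op (LinearMap.proj j ∘ₗ t)) (u j).2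
      · obtain ⟨c, hc⟩ := (Submodule.mem_span_range_iff_exists_fun _).1
          (hu ▸ Submodule.mem_top : (⟨g, hg⟩ : LinearMap.ker π) ∈ _)
        have hgc : g = ∑ j, c j • (u j).1 := by
          refine (congrArg Subtype.val hc).symm.trans ?_
          simp
        rw [hgc]
        refine Submodule.sum_mem _ fun j _ => Submodule.smul_mem _ _ ?_
        rw [← hU' j]
        ext x
        exact (Submodule.Quotient.mk_eq_zero _).2 ⟨Pi.single j x, rfl⟩
    have := hfin (FGModuleCat.of Λᵐᵒᵖ ((Fin n → P) ⧸ LinearMap.range U))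
    let e := (ρ.quotKerEquivOfSurjective hρ).symm ≪≫ₗ Submodule.quotEquivOfEq _ _ hker ≪≫ₗ
      π.quotKerEquivOfSurjective hπ
    exact ⟨⟨FGModuleCat.of Λᵐᵒᵖ ((Fin n → P) ⧸ LinearMap.range U), hX⟩,
      ⟨LinearEquiv.toFGModuleCatIso (W := N) e⟩⟩

theorem IsWide.exists_equivalence_of_progenerator (R : Type v) [CommRing R] [IsArtinianRing R]
    [Algebra R Λᵐᵒᵖ] [Module.Finite R Λᵐᵒᵖ] (hW : IsWide W) (hPW : W P)
    (hP : IsRelProjective W P) (hgen : IsGenerator W P) :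
    ∃ (S : Type u) (_ : CommRing S) (Γ : Type u) (_ : Ring Γ) (_ : Algebra S Γ),
      IsArtinAlgebra S Γ ∧ Nonempty (W.FullSubcategory ≌ RMod Γ) := by
  obtain ⟨S, _, _, hS, _⟩ := Module.End.isArtinAlgebra R (A := Λᵐᵒᵖ) (P := P)
  have hfin : ∀ X : RMod Λ, Module.Finite (Module.End Λᵐᵒᵖ P)ᵐᵒᵖ (P →ₗ[Λᵐᵒᵖ] X) :=
    fun X => LinearMap.rightEndModule_finite R
  have := homFunctor_faithful hfin hgen
  have := hW.homFunctor_full hPW hfin hP hgen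
  have := hW.homFunctor_essSurj hPW hfin hP
  have : (homFunctor W P hfin).IsEquivalence := { }
  exact ⟨S, _, Module.End Λᵐᵒᵖ P, _, _, hS, ⟨(homFunctor W P hfin).asEquivalence⟩⟩

end RMod

/-! ### From an equivalence with `mod Γ` back to a progenerator. -/

namespace RMod

variable {Λ : Type u} [Ring Λ] {W : ObjectProperty (RMod Λ)}

theorem projective_regular (Γ : Type u) [Ring Γ] [IsNoetherianRing Γᵐᵒᵖ] :
    Projective (FGModuleCat.of Γᵐᵒᵖ Γᵐᵒᵖ : RMod Γ) where
  factors {E X} f p hp := by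
    obtain ⟨y, hy⟩ := (FGModuleCat.epi_iff_surjective p).1 hp (f.hom.hom (1 : Γᵐᵒᵖ))
    refine ⟨FGModuleCat.ofHom (W := E) (LinearMap.toSpanSingleton Γᵐᵒᵖ E y), ?_⟩
    refine FGModuleCat.hom_ext (LinearMap.ext_ring ?_)
    exact (congrArg p.hom.hom (one_smul Γᵐᵒᵖ y)).trans hy

/-- Surjective maps between modules of `W` are epimorphisms in `W`, so categorical projectivity
suffices. -/
theorem isRelProjective_of_projective {P : W.FullSubcategory} (hP : Projective P) :
    IsRelProjective W P.obj := by
  intro M N _ _ _ _ _ _ hM hN p g hp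
  let M' : W.FullSubcategory := ⟨FGModuleCat.of Λᵐᵒᵖ M, hM⟩
  let N' : W.FullSubcategory := ⟨FGModuleCat.of Λᵐᵒᵖ N, hN⟩
  let p' : M' ⟶ N' := ObjectProperty.homMk (FGModuleCat.ofHom p)
  let g' : P ⟶ N' := ObjectProperty.homMk (FGModuleCat.ofHom (V := P.obj) g)
  have : Epi p' := ⟨fun {Z} a b hab => by
    ext y
    obtain ⟨x, rfl⟩ := hp y
    exact congr(($hab).hom.hom.hom x)⟩
  exact ⟨(Projective.factorThru g' p').hom.hom.hom,
    congr(($(Projective.factorThru_comp g' p')).hom.hom.hom)⟩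

variable [IsNoetherianRing Λᵐᵒᵖ]

/-- Generators of the `Γ`-module corresponding to `M` transport to maps from the image of the
regular module into `M`. The projection of `M` onto the cokernel of their sum lies in `W` and
corresponds to a map vanishing on those generators, so it is zero. -/
theorem IsWide.isGenerator_of_equivalence (hW : IsWide W) {Γ : Type u} [Ring Γ]
    (e : W.FullSubcategory ≌ RMod Γ) :
    IsGenerator W (e.inverse.obj (FGModuleCat.of Γᵐᵒᵖ Γᵐᵒᵖ)).obj := by
  intro M _ _ _ hM
  let X : W.FullSubcategory := ⟨FGModuleCat.of Λᵐᵒᵖ M, hM⟩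
  obtain ⟨n, y, hy⟩ := Module.Finite.exists_fin (R := Γᵐᵒᵖ) (M := e.functor.obj X)
  let c : Fin n → (FGModuleCat.of Γᵐᵒᵖ Γᵐᵒᵖ ⟶ e.functor.obj X) := fun i =>
    FGModuleCat.ofHom (W := e.functor.obj X) (LinearMap.toSpanSingleton Γᵐᵒᵖ _ (y i))
  let t : Fin n → (e.inverse.obj (FGModuleCat.of Γᵐᵒᵖ Γᵐᵒᵖ) ⟶ X) := fun i =>
    e.inverse.map (c i) ≫ e.unitInv.app X
  obtain ⟨h, -, hh⟩ := LinearMap.exists_eq_of_apply_single fun i => (t i).hom.hom.hom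
  have hPn := hW.contains_pi n (e.inverse.obj (FGModuleCat.of Γᵐᵒᵖ Γᵐᵒᵖ)).property
  let C : W.FullSubcategory := ⟨FGModuleCat.of Λᵐᵒᵖ (M ⧸ LinearMap.range h),
    hW.contains_quotient_range h hPn hM⟩
  let q : X ⟶ C := ObjectProperty.homMk (FGModuleCat.ofHom (LinearMap.range h).mkQ)
  -- Comparing `q` with an explicit zero map needs only that `e` is faithful, not that it is
  -- additive.
  let z : X ⟶ C := ObjectProperty.homMk (FGModuleCat.ofHom 0)
  have htq : ∀ i, t i ≫ q = t i ≫ z := fun i => by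
    ext x
    refine (Submodule.Quotient.mk_eq_zero _).2 ?_
    exact ⟨LinearMap.single Λᵐᵒᵖ _ i x, congr($(hh i) x)⟩
  have hcq : ∀ i, c i ≫ e.functor.map q = c i ≫ e.functor.map z := fun i => by
    apply e.inverse.map_injective
    rw [← cancel_mono (e.unitInv.app C)]
    have nat : ∀ r : X ⟶ C, e.inverse.map (c i ≫ e.functor.map r) ≫ e.unitInv.app C = t i ≫ r := by
      intro r
      rw [Functor.map_comp, Category.assoc, Category.assoc]
      exact congrArg (e.inverse.map (c i) ≫ ·) (e.unitInv.naturality r)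
    rw [nat, nat, htq]
  have hqz : q = z := by
    apply e.functor.map_injective
    refine FGModuleCat.hom_ext (LinearMap.ext_on_range hy fun i => ?_)
    have : (c i).hom.hom (1 : Γᵐᵒᵖ) = y i := one_smul _ _
    rw [← this]
    exact congr(($(hcq i)).hom.hom (1 : Γᵐᵒᵖ))
  refine ⟨n, h, fun m => ?_⟩
  exact (Submodule.Quotient.mk_eq_zero _).1 congr(($hqz).hom.hom.hom m)

end RMod

/-! ### The equivalence of the five conditions. -/

theorem IsArtinAlgebra.isNoetherianRing_op {S : Type v} {Γ : Type u} [CommRing S] [Ring Γ]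
    [Algebra S Γ] (h : IsArtinAlgebra S Γ) : IsNoetherianRing Γᵐᵒᵖ := by
  have := h.isArtinianRing
  have := h.finite
  have : Module.Finite S Γᵐᵒᵖ := Module.Finite.equiv (MulOpposite.opLinearEquiv S)
  exact IsNoetherianRing.of_finite S _

theorem proposition4p8 (R : Type v) [CommRing R] (Λ : Type u) [Ring Λ] [Algebra R Λ]
    (hΛ : IsArtinAlgebra R Λ) (W : ObjectProperty (RMod Λ)) (hW : RMod.IsWide W) :
    List.TFAE [
      RMod.IsFunctoriallyFinite W,
      RMod.IsCovariantlyFinite W,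
      RMod.IsContravariantlyFinite W,
      ∃ P : RMod Λ, RMod.IsExtProgenerator W P,
      ∃ (S : Type u) (_ : CommRing S) (Γ : Type u) (_ : Ring Γ) (_ : Algebra S Γ),
        IsArtinAlgebra S Γ ∧ Nonempty (W.FullSubcategory ≌ RMod Γ)] := by
  have := hΛ.isArtinianRing
  have := hΛ.finite
  have : Module.Finite R Λᵐᵒᵖ := Module.Finite.equiv (MulOpposite.opLinearEquiv R)
  have : IsArtinianRing Λᵐᵒᵖ := IsArtinianRing.of_finite R _
  simp only [hW.isExtProgenerator_iff]
  tfae_have 1 → 3 := fun h => h.2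
  tfae_have 3 → 2 := fun h => by
    obtain ⟨Z, z, hZ, hz⟩ := hW.exists_isUniversalElement_of_isContravariantlyFinite R h
    exact hW.isCovariantlyFinite_of_isUniversalElement hZ hz
  tfae_have 2 → 4 := fun h => by
    obtain ⟨Z, z, hZ, hz⟩ := h.exists_isUniversalElement
    exact hW.exists_progenerator_of_isUniversalElement hZ hz
  tfae_have 4 → 1 := by
    rintro ⟨P, hPW, -, hgen⟩
    obtain ⟨Z, z, hZ, hz⟩ := hW.exists_isUniversalElement_of_isGenerator R hPW hgen
    exact ⟨hW.isCovariantlyFinite_of_isUniversalElement hZ hz,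
      hW.isContravariantlyFinite_of_progenerator R hPW hgen⟩
  tfae_have 4 → 5 := by
    rintro ⟨P, hPW, hP, hgen⟩
    exact hW.exists_equivalence_of_progenerator R hPW hP hgen
  tfae_have 5 → 4 := by
    rintro ⟨S, _, Γ, _, _, hΓ, ⟨e⟩⟩
    have := hΓ.isNoetherianRing_op
    have hproj : Projective (e.inverse.obj (FGModuleCat.of Γᵐᵒᵖ Γᵐᵒᵖ)) :=
      (e.symm.map_projective_iff _).2 (RMod.projective_regular Γ)
    exact ⟨_, (e.inverse.obj _).property, RMod.isRelProjective_of_projective hproj,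
      hW.isGenerator_of_equivalence e⟩
  tfae_finish
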